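/- **Setting.** Let $N$ be a finite set of players with weights $w_i>0$. A network $g$ on $N$ is a set of links $ij$ ($i\ne j$ in $N$); $N(g)$ is the set of players having a link in $g$, $L_i(g)$ the set of links of $i$ in $g$, and $C(g)$ the set of components of $g$ (nonempty maximal connected sub-networks). $\mathbb H^N$ is the set of real functions $v$ on networks with $v(\emptyset)=0$ and $v(g)=\sum_{h\in C(g)}v(h)$ for all $g$. $v$ is zero-monotonic on $g$ if $v(g')-v(L_i(g'))\ge v(g'-L_i(g'))$ for all $g'\subseteq g$ and $i\in N(g')$. The weighted Myerson value is $$Y_i^{w\text{-}MV}(g,v)=\sum_{g'\subseteq g:\ i\in N(g')}\frac{w_i}{\sum_{j\in N(g')}w_j}\,\lambda_{g'}(v),\qquad \lambda_{g'}(v)=\sum_{g''\subseteq g'}(-1)^{|g'|-|g''|}v(g'').$$ **Mechanism $\Gamma^{w\text{-}MV}(g,v)$** (defined by recursion on the number of links). A player without links receives $0$. On each component $h$ of $g$, separately and in parallel, the following round is played. 1. All $i\in N(h)$ simultaneously announce bids $b^i_j\in\mathbb R$ to all $j\in N(h)\setminus\{i\}$. Let $B^i=\sum_{j\ne i}w_ib^i_j-\sum_{j\neq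 i}w_jb^j_i$. A proposer $i^*$ is drawn with equal probability among the players with maximal $B^i$, and pays $b^{i^*}_j$ to each $j\in N(h)\setminus\{i^*\}$. 2. $i^*$ offers $y_j\in\mathbb R$ to each $j\in N(h)\setminus\{i^*\}$. 3. The players in $N(h)\setminus\{i^*\}$ accept or reject one after the other, in a fixed order. If all accept, each $j\ne i^*$ additionally receives $y_j$, $i^*$ additionally receives $v(h)-\sum_{j\ne i^*}y_j$, and play on $h$ ends. If at least one rejects, the mechanism $\Gamma^{w\text{-}MV}(h-L_{i^*}(h),v)$ is played, its payoffs being added to the payments already made. All past actions in a round, and in the rounds that led to it, are observed; strategies are pure and may depend on the whole observed history; payoffs are expected total payments. **Theorem.** Let $g$ be a network on $N$ and let $v\in\mathbb H^N$ be zero-monotonic on $g$, with $v(\{ij\})\ge 0$ for every single link $ij\in g$. Then in every subgame perfect Nash equilibrium of $\Gamma^{w\text{-}MV}(g,v)$ the payoff of every player $i\in N$ equals $Y_i^{w\text{-}MV}(g,v)$. Moreover this holds not only for the expected payoffs but for every payoff vector that occurs with positive probability in the equilibrium. -/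

import Mathlib

open scoped Classical in
/-- `N(g)`: the players that have at least one link in the network `g`. -/
noncomputable def players {N : Type} [Fintype N] (g : SimpleGraph N) : Finset N :=
  Finset.univ.filter fun i => ∃ j, g.Adj i j

/-- `|g|`: the number of links of `g`. -/
noncomputable def numLinks {N : Type} (g : SimpleGraph N) : ℕ := g.edgeSet.ncard

/-- `L_i(g) = g_i`: the sub-network that consists of the links of player `i` in `g`. -/
def linksOf {N : Type} (g : SimpleGraph N) (i : N) : SimpleGraph N where
  Adj a b := g.Adj a b ∧ (a = i ∨ b = i)
  symm := ⟨fun _ _ h => ⟨h.1.symm, h.2.symm⟩⟩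
  loopless := ⟨fun _ h => h.1.ne rfl⟩

/-- `h` is a component of `g`: a nonempty maximal connected sub-network. -/
def IsNetworkComponent {N : Type} [Fintype N] (g h : SimpleGraph N) : Prop :=
  h ≠ ⊥ ∧ h ≤ g ∧
    (∀ i ∈ players h, ∀ j ∈ players h, h.Reachable i j) ∧
    (∀ i ∈ players h, ∀ j, g.Adj i j → h.Adj i j)

open scoped Classical in
/-- `C(g)`: the set of components of `g`. -/
noncomputable def netComponents {N : Type} [Fintype N] (g : SimpleGraph N) :
    Finset (SimpleGraph N) :=
  Finset.univ.filter fun h => IsNetworkComponent g h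

theorem isNetworkComponent_of_mem {N : Type} [Fintype N] {g h : SimpleGraph N}
    (hh : h ∈ netComponents g) : IsNetworkComponent g h := by
  simpa [netComponents] using hh

/-- `v` is a component additive value function (an element of `H^N`). -/
structure IsComponentAdditive {N : Type} [Fintype N] (v : SimpleGraph N → ℝ) : Prop where
  empty : v ⊥ = 0
  additive : ∀ g, v g = ∑ h ∈ netComponents g, v h

/-- Zero-monotonicity of `v` on (the sub-networks of) `g`. -/
def IsZeroMonotonic {N : Type} [Fintype N] (g : SimpleGraph N) (v : SimpleGraph N → ℝ) : Prop :=
  ∀ g' ≤ g, ∀ i ∈ players g', v g' - v (linksOf g' i) ≥ v (g' \ linksOf g' i)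

open scoped Classical in
/-- The Harsanyi dividend (unanimity coefficient) `λ_g(v)`. -/
noncomputable def dividend {N : Type} [Fintype N] (v : SimpleGraph N → ℝ)
    (g : SimpleGraph N) : ℝ :=
  ∑ g' ∈ Finset.univ.filter (fun g' : SimpleGraph N => g' ≤ g),
    (-1 : ℝ) ^ (numLinks g - numLinks g') * v g'

open scoped Classical in
/-- The weighted Myerson value of player `i`. -/
noncomputable def weightedMyerson {N : Type} [Fintype N] (w : N → ℝ) (g : SimpleGraph N)
    (v : SimpleGraph N → ℝ) (i : N) : ℝ :=
  ∑ g' ∈ Finset.univ.filter (fun g' : SimpleGraph N => g' ≤ g ∧ i ∈ players g'),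
    w i / (∑ j ∈ players g', w j) * dividend v g'

/-- Finite-horizon extensive games with observed actions. -/
inductive ExtGame (N : Type) : Type 1
  /-- The game is over and player `i` receives `u i`. -/
  | terminal (u : N → ℝ) : ExtGame N
  /-- Player `i` receives `t i`, and then `G` is played. -/
  | transfer (t : N → ℝ) (G : ExtGame N) : ExtGame N
  /-- The players in `S` simultaneously choose actions, player `i` an element of `A i`; the
  choices become known, and the game goes on with `next`. -/
  | move (S : Finset N) (A : N → Type) (next : ((i : S) → A i) → ExtGame N) : ExtGame N
  /-- An element of `W` is drawn by chance, each with equal probability. -/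
  | lottery (W : Finset N) (next : W → ExtGame N) : ExtGame N
  /-- Finitely many games are played separately; a player's payoffs in them are added up. -/
  | parallel (κ : Type) (fin : Fintype κ) (G : κ → ExtGame N) : ExtGame N

namespace ExtGame

variable {N : Type}

/-- The (pure, history dependent) strategies of player `i`: an action of `i` at each node where
`i` moves. -/
def Strategy (i : N) : ExtGame N → Type
  | terminal _ => Unit
  | transfer _ G => Strategy i G
  | move S A next => (i ∈ S → A i) × ((a : (j : S) → A j) → Strategy i (next a))
  | lottery W next => (k : W) → Strategy i (next k)
  | parallel κ _ G => (k : κ) → Strategy i (G k)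

/-- Strategy profiles. -/
def Profile (G : ExtGame N) : Type := (i : N) → Strategy i G

/-- The continuation of a profile after a transfer. -/
def Profile.afterTransfer {t : N → ℝ} {G : ExtGame N} (σ : Profile (transfer t G)) :
    Profile G := fun i => σ i

/-- The actions that a profile prescribes at an initial move. -/
def Profile.actions {S : Finset N} {A : N → Type} {next : ((i : S) → A i) → ExtGame N}
    (σ : Profile (move S A next)) : (i : S) → A i := fun i => (σ i).1 i.2

/-- The continuation of a profile after the actions `a` at an initial move. -/
def Profile.afterMove {S : Finset N} {A : N → Type} {next : ((i : S) → A i) → ExtGame N}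
    (σ : Profile (move S A next)) (a : (i : S) → A i) : Profile (next a) := fun i => (σ i).2 a

/-- The continuation of a profile after `k` has been drawn. -/
def Profile.afterDraw {W : Finset N} {next : W → ExtGame N}
    (σ : Profile (lottery W next)) (k : W) : Profile (next k) := fun i => σ i k

/-- The part of a profile that concerns the `k`-th of several parallel games. -/
def Profile.inParallel {κ : Type} {fin : Fintype κ} {G : κ → ExtGame N}
    (σ : Profile (parallel κ fin G)) (k : κ) : Profile (G k) := fun i => σ i k

/-- The expected payoff vector when the profile `σ` is played. -/
noncomputable def payoff : (G : ExtGame N) → Profile G → N → ℝ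
  | terminal u, _ => u
  | transfer t G, σ => fun i => t i + payoff G σ.afterTransfer i
  | move _ _ next, σ => payoff (next σ.actions) (σ.afterMove σ.actions)
  | lottery W next, σ => fun i => (∑ k : W, payoff (next k) (σ.afterDraw k) i) / (W.card : ℝ)
  | parallel κ fin G, σ => fun i =>
      (@Finset.univ κ fin).sum fun k => payoff (G k) (σ.inParallel k) i

/-- The payoff vectors that are realized with positive probability when `σ` is played. -/
def outcomes : (G : ExtGame N) → Profile G → Set (N → ℝ)
  | terminal u, _ => {u}
  | transfer t G, σ => {x | ∃ y ∈ outcomes G σ.afterTransfer, x = fun i => t i + y i}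
  | move _ _ next, σ => outcomes (next σ.actions) (σ.afterMove σ.actions)
  | lottery W next, σ => {x | ∃ k : W, x ∈ outcomes (next k) (σ.afterDraw k)}
  | parallel κ fin G, σ => {x | ∃ y : κ → N → ℝ,
      (∀ k, y k ∈ outcomes (G k) (σ.inParallel k)) ∧
        x = fun i => (@Finset.univ κ fin).sum fun k => y k i}

open scoped Classical in
/-- `σ` is a Nash equilibrium of `G`. -/
def IsNash (G : ExtGame N) (σ : Profile G) : Prop :=
  ∀ (i : N) (s : Strategy i G), payoff G (Function.update σ i s) i ≤ payoff G σ i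

/-- `σ` is a subgame perfect Nash equilibrium: it induces a Nash equilibrium in every subgame. -/
def IsSubgamePerfect : (G : ExtGame N) → Profile G → Prop
  | terminal u, σ => IsNash (terminal u) σ
  | transfer t G, σ => IsNash (transfer t G) σ ∧ IsSubgamePerfect G σ.afterTransfer
  | move S A next, σ => IsNash (move S A next) σ ∧
      ∀ a, IsSubgamePerfect (next a) (σ.afterMove a)
  | lottery W next, σ => IsNash (lottery W next) σ ∧
      ∀ k, IsSubgamePerfect (next k) (σ.afterDraw k)
  | parallel κ fin G, σ => IsNash (parallel κ fin G) σ ∧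
      ∀ k, IsSubgamePerfect (G k) (σ.inParallel k)

end ExtGame

theorem numLinks_sdiff_linksOf_lt {N : Type} [Fintype N] {g h : SimpleGraph N} (hg : h ≤ g) {i : N}
    (hi : i ∈ players h) : numLinks (h \ linksOf h i) < numLinks g := by
  classical
  obtain ⟨j, hj⟩ := (Finset.mem_filter.1 hi).2
  refine lt_of_lt_of_le (Set.ncard_lt_ncard ?_ (Set.toFinite _))
    (Set.ncard_le_ncard (SimpleGraph.edgeSet_mono hg) (Set.toFinite _))
  refine SimpleGraph.edgeSet_strict_mono (lt_of_le_of_ne sdiff_le ?_)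
  intro h1
  have h2 : (h \ linksOf h i).Adj i j := by rw [h1]; exact hj
  exact h2.2 ⟨hj, Or.inl rfl⟩

section Mechanism

variable {N : Type} [Fintype N] [LinearOrder N]

/-- The numbers that player `i` chooses for the other players of `h`: his bids, or, if he is the
proposer, his offer. -/
abbrev Promise (h : SimpleGraph N) (i : N) : Type := {j // j ∈ (players h).erase i} → ℝ

/-- The bid `b^i_j` (zero unless `i` and `j` are different players of `h`). -/
noncomputable def bidOf (h : SimpleGraph N) (β : (i : players h) → Promise h i) (i j : N) : ℝ :=
  if hi : i ∈ players h then
    if hj : j ∈ (players h).erase i then β ⟨i, hi⟩ ⟨j, hj⟩ else 0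
  else 0

/-- The weighted net bid `B^i`. -/
noncomputable def netBid (w : N → ℝ) (h : SimpleGraph N) (b : N → N → ℝ) (i : N) : ℝ :=
  ∑ j ∈ (players h).erase i, w i * b i j - ∑ j ∈ (players h).erase i, w j * b j i

/-- The players with the highest net bid. -/
noncomputable def topBidders (w : N → ℝ) (h : SimpleGraph N) (b : N → N → ℝ) : Finset N :=
  (players h).filter fun i => ∀ j ∈ players h, netBid w h b j ≤ netBid w h b i

theorem mem_players_of_mem_topBidders {w : N → ℝ} {h : SimpleGraph N} {b : N → N → ℝ} {i : N}
    (hi : i ∈ topBidders w h b) : i ∈ players h := (Finset.mem_filter.1 hi).1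

/-- The proposer `i` pays his bids to the other players. -/
noncomputable def bidPayments (h : SimpleGraph N) (b : N → N → ℝ) (i : N) : N → ℝ := fun j =>
  if j = i then - ∑ k ∈ (players h).erase i, b i k else b i j

/-- The payoffs when the offer `y` of the proposer `i` is accepted. -/
noncomputable def acceptPayoffs (v : SimpleGraph N → ℝ) (h : SimpleGraph N) (i : N)
    (y : Promise h i) : N → ℝ := fun j =>
  if hj : j ∈ (players h).erase i then y ⟨j, hj⟩
  else if j = i then v h - ∑ k, y k else 0

/-- The players in the list decide one after the other, observing the earlier decisions, whether
to accept (`true`) or reject (`false`); the game goes on with `next true` if everybody accepts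
and with `next false` otherwise. -/
def respond (next : Bool → ExtGame N) : List N → Bool → ExtGame N
  | [], acc => next acc
  | j :: l, acc => ExtGame.move {j} (fun _ => Bool) fun d =>
      respond next l (acc && d ⟨j, Finset.mem_singleton_self j⟩)

/-- One round on the connected network `h`: bids, draw of the proposer among the top bidders and
payment of his bids, his offer, and the responses. After a rejection by at least one player the
game goes on with `next i`, where `i` is the proposer. -/
noncomputable def biddingRound (w : N → ℝ) (v : SimpleGraph N → ℝ) (h : SimpleGraph N)
    (next : players h → ExtGame N) : ExtGame N :=
  ExtGame.move (players h) (fun i => Promise h i) fun β =>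
    ExtGame.lottery (topBidders w h (bidOf h β)) fun i =>
      ExtGame.transfer (bidPayments h (bidOf h β) i) <|
        ExtGame.move {i.1} (fun k => Promise h k) fun y =>
          respond
            (fun acc => if acc = true
              then ExtGame.terminal
                (acceptPayoffs v h i (y ⟨i.1, Finset.mem_singleton_self i.1⟩))
              else next ⟨i.1, mem_players_of_mem_topBidders i.2⟩)
            (((players h).erase i.1).sort (· ≤ ·)) true

/-- The bidding mechanism `Γ^{w-MV}(g,v)`: a round is played on each component `h` of `g`
separately; if the offer of the proposer `i` is rejected, the mechanism is played on `h` without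
the links of `i`. If `g` has no links, everybody receives zero. -/
noncomputable def biddingMechanism (w : N → ℝ) (v : SimpleGraph N → ℝ) (g : SimpleGraph N) :
    ExtGame N :=
  ExtGame.parallel {h // h ∈ netComponents g} inferInstance fun h =>
    biddingRound w v h.1 fun i => biddingMechanism w v (h.1 \ linksOf h.1 i.1)
termination_by numLinks g
decreasing_by
  exact numLinks_sdiff_linksOf_lt (isNetworkComponent_of_mem h.2).2.1 i.2

end Mechanism

/-! ### Dividends and the recursion for the weighted Myerson value. -/

section Networks

variable {N : Type} [Fintype N]

/-! The proof is backward induction over sub-networks, with the stronger claim that every subgame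
perfect equilibrium surely pays `weightedMyerson` (`Determined`).

Consider a round on a component h with proposer i. By induction a rejection leads to the payoffs c =
Y(h - L_i), with c i = 0 and total v(h - L_i) by efficiency. Zero-monotonicity and nonnegative links
give v(h - L_i) ≤ v(h). The proposer can buy acceptance for slightly more than c, so every
equilibrium of the offer stage gives c j to each j ≠ i and v(h) - v(h - L_i) to i. If the offer is
rejected, the surplus is zero and the payoffs are the same (`determined_offer`).

In the bidding stage all net bids must be equal, hence zero since they sum to zero, and every player
must be indifferent as to who proposes. Averaging i's payoff over the proposers j with weights w_j
cancels the bids, because the weighted sum of the payments to i is -B^i = 0. With W the total weight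
of the players of h, what remains is W u_i = w_i (v(h) - v(h - L_i)) + ∑_{j ≠ i} w_j Y_i(h - L_j)
(`IsBiddingEquilibrium.weighted_payoff_eq`).

This is exactly the recursion satisfied by Y (`weightedMyerson_recursion`). Indifference holds for
each proposer separately, so the lottery leaves no uncertainty in the payoffs. The components are
then added up by `weightedMyerson_eq_sum_netComponents`, which rests on the vanishing of dividends
of disconnected networks. -/

theorem mem_players {g : SimpleGraph N} {i : N} : i ∈ players g ↔ ∃ j, g.Adj i j := by
  simp [players]

theorem players_mono {g h : SimpleGraph N} (hgh : g ≤ h) : players g ⊆ players h := by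
  intro i hi
  obtain ⟨j, hj⟩ := mem_players.1 hi
  exact mem_players.2 ⟨j, hgh hj⟩

theorem players_nonempty {g : SimpleGraph N} (hg : g ≠ ⊥) : (players g).Nonempty := by
  obtain ⟨a, b, hab⟩ := SimpleGraph.ne_bot_iff_exists_adj.1 hg
  exact ⟨a, mem_players.2 ⟨b, hab⟩⟩

theorem le_sdiff_linksOf_iff {g h : SimpleGraph N} {i : N} :
    g ≤ h \ linksOf h i ↔ g ≤ h ∧ i ∉ players g := by
  constructor
  · intro hg
    refine ⟨hg.trans sdiff_le, fun hi => ?_⟩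
    obtain ⟨j, hj⟩ := mem_players.1 hi
    exact (hg hj).2 ⟨(hg hj).1, Or.inl rfl⟩
  · rintro ⟨hg, hi⟩ a b hab
    refine ⟨hg hab, ?_⟩
    rintro ⟨-, rfl | rfl⟩
    · exact hi (mem_players.2 ⟨b, hab⟩)
    · exact hi (mem_players.2 ⟨a, hab.symm⟩)

theorem notMem_players_sdiff_linksOf (h : SimpleGraph N) (i : N) :
    i ∉ players (h \ linksOf h i) :=
  (le_sdiff_linksOf_iff.1 le_rfl).2

-- Networks between k and g correspond to sets of links of g outside k, and the alternating sum over
-- the subsets of a nonempty finite set vanishes.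
open scoped Classical in
theorem sum_Icc_neg_one_pow_numLinks {k g : SimpleGraph N} (hkg : k ≤ g) :
    ∑ g' ∈ Finset.univ.filter (fun g' : SimpleGraph N => k ≤ g' ∧ g' ≤ g),
      (-1 : ℝ) ^ (numLinks g' - numLinks k) = if k = g then 1 else 0 := by
  have key : ∑ g' ∈ Finset.univ.filter (fun g' : SimpleGraph N => k ≤ g' ∧ g' ≤ g),
      (-1 : ℝ) ^ (numLinks g' - numLinks k) =
      ∑ s ∈ (g \ k).edgeFinset.powerset, (-1 : ℝ) ^ s.card := by
    refine Finset.sum_bij' (fun g' _ => (g' \ k).edgeFinset)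
      (fun s _ => k ⊔ SimpleGraph.fromEdgeSet (s : Set (Sym2 N))) ?_ ?_ ?_ ?_ ?_
    · intro g' hg'
      simp only [Finset.mem_filter, Finset.mem_univ, true_and] at hg'
      rw [Finset.mem_powerset, SimpleGraph.edgeFinset_subset_edgeFinset]
      exact sdiff_le_sdiff_right hg'.2
    · intro s hs
      rw [Finset.mem_powerset] at hs
      simp only [Finset.mem_filter, Finset.mem_univ, true_and]
      refine ⟨le_sup_left, sup_le hkg ?_⟩
      intro a b hab
      have h1 := hs (Finset.mem_coe.1 ((SimpleGraph.fromEdgeSet_adj _).1 hab).1)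
      rw [SimpleGraph.mem_edgeFinset, SimpleGraph.mem_edgeSet] at h1
      exact h1.1
    · intro g' hg'
      simp only [Finset.mem_filter, Finset.mem_univ, true_and] at hg'
      simp only [SimpleGraph.coe_edgeFinset, SimpleGraph.fromEdgeSet_edgeSet]
      exact sup_sdiff_cancel_right hg'.1
    · intro s hs
      rw [Finset.mem_powerset] at hs
      ext e
      induction e with
      | h a b =>
        simp only [SimpleGraph.mem_edgeFinset, SimpleGraph.mem_edgeSet, SimpleGraph.sdiff_adj,
          SimpleGraph.sup_adj, SimpleGraph.fromEdgeSet_adj, Finset.mem_coe]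
        constructor
        · rintro ⟨h1 | h1, h2⟩
          · exact absurd h1 h2
          · exact h1.1
        · intro h1
          have h2 := hs h1
          rw [SimpleGraph.mem_edgeFinset, SimpleGraph.mem_edgeSet] at h2
          exact ⟨Or.inr ⟨h1, h2.1.ne⟩, h2.2⟩
    · intro g' hg'
      simp only [Finset.mem_filter, Finset.mem_univ, true_and] at hg'
      congr 1
      rw [numLinks, numLinks, ← Set.ncard_sdiff (SimpleGraph.edgeSet_mono hg'.1) (Set.toFinite _),
        ← SimpleGraph.edgeSet_sdiff, ← SimpleGraph.coe_edgeFinset, Set.ncard_coe_finset]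
  rw [key]
  have h2 := congrArg (Int.cast : ℤ → ℝ)
    (Finset.sum_powerset_neg_one_pow_card (x := (g \ k).edgeFinset))
  push_cast at h2
  rw [h2]
  refine if_congr ?_ rfl rfl
  rw [SimpleGraph.edgeFinset_eq_empty, sdiff_eq_bot_iff]
  exact ⟨fun h => le_antisymm hkg h, fun h => h.ge⟩

-- Möbius inversion: after swapping the sums, the coefficient of v k is an alternating sum over the
-- interval from k to g.
open scoped Classical in
theorem sum_dividend (v : SimpleGraph N → ℝ) (g : SimpleGraph N) :
    ∑ g' ∈ Finset.univ.filter (fun g' : SimpleGraph N => g' ≤ g), dividend v g' = v g := by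
  simp only [dividend]
  rw [Finset.sum_comm' (t' := Finset.univ.filter (fun k : SimpleGraph N => k ≤ g))
    (s' := fun k => Finset.univ.filter (fun g' : SimpleGraph N => k ≤ g' ∧ g' ≤ g))]
  · simp_rw [← Finset.sum_mul]
    rw [Finset.sum_eq_single g]
    · rw [sum_Icc_neg_one_pow_numLinks le_rfl]; simp
    · intro k hk hkg
      rw [sum_Icc_neg_one_pow_numLinks (Finset.mem_filter.1 hk).2, if_neg hkg, zero_mul]
    · simp
  · intro x y
    simp only [Finset.mem_filter, Finset.mem_univ, true_and]
    exact ⟨fun h => ⟨⟨h.2, h.1⟩, h.2.trans h.1⟩, fun h => ⟨h.1.2, h.1.1⟩⟩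

theorem dividend_bot (v : SimpleGraph N → ℝ) : dividend v ⊥ = v ⊥ := by
  classical
  refine Eq.trans (Finset.sum_eq_single ⊥ ?_ ?_).symm (sum_dividend v ⊥)
  · intro k hk hne
    exact absurd (le_bot_iff.1 (Finset.mem_filter.1 hk).2) hne
  · simp

-- Deleting the links of i removes exactly the sub-networks in which i has a link, so only their
-- dividends survive in the difference.
open scoped Classical in
theorem sub_sdiff_linksOf_eq_sum_dividend (v : SimpleGraph N → ℝ) (h : SimpleGraph N) (i : N) :
    v h - v (h \ linksOf h i) =
      ∑ g' ∈ Finset.univ.filter (fun g' : SimpleGraph N => g' ≤ h ∧ i ∈ players g'),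
        dividend v g' := by
  rw [← sum_dividend v h, ← sum_dividend v (h \ linksOf h i)]
  simp only [le_sdiff_linksOf_iff]
  rw [sub_eq_iff_eq_add,
    ← Finset.sum_filter_add_sum_filter_not _ (fun g' : SimpleGraph N => i ∈ players g')]
  simp only [Finset.filter_filter]

open scoped Classical in
theorem weightedMyerson_sdiff_linksOf (w : N → ℝ) (h : SimpleGraph N) (v : SimpleGraph N → ℝ)
    (i j : N) : weightedMyerson w (h \ linksOf h j) v i =
      ∑ g' ∈ Finset.univ.filter (fun g' : SimpleGraph N => g' ≤ h ∧ i ∈ players g'),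
        if j ∉ players g' then w i / (∑ k ∈ players g', w k) * dividend v g' else 0 := by
  rw [weightedMyerson, ← Finset.sum_filter, Finset.filter_filter]
  refine Finset.sum_congr (Finset.filter_congr fun g' _ => ?_) fun _ _ => rfl
  rw [le_sdiff_linksOf_iff]
  tauto

theorem weightedMyerson_eq_zero (w : N → ℝ) (g : SimpleGraph N) (v : SimpleGraph N → ℝ) {i : N}
    (hi : i ∉ players g) : weightedMyerson w g v i = 0 := by
  classical
  rw [weightedMyerson]
  refine Finset.sum_eq_zero fun g' hg' => ?_
  have h := (Finset.mem_filter.1 hg').2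
  exact absurd (players_mono h.1 h.2) hi

theorem sum_players_pos {w : N → ℝ} (hw : ∀ i, 0 < w i) {g : SimpleGraph N} {i : N}
    (hi : i ∈ players g) : 0 < ∑ k ∈ players g, w k :=
  Finset.sum_pos (fun k _ => hw k) ⟨i, hi⟩

/-- The recursion that characterizes the weighted Myerson value. -/
theorem weightedMyerson_recursion {w : N → ℝ} (hw : ∀ i, 0 < w i) (h : SimpleGraph N)
    (v : SimpleGraph N → ℝ) (i : N) :
    (∑ k ∈ players h, w k) * weightedMyerson w h v i =
      w i * (v h - v (h \ linksOf h i)) +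
        ∑ j ∈ players h, w j * weightedMyerson w (h \ linksOf h j) v i := by
  classical
  rw [sub_sdiff_linksOf_eq_sum_dividend]
  simp_rw [weightedMyerson_sdiff_linksOf]
  simp_rw [Finset.mul_sum]
  rw [Finset.sum_comm, ← Finset.sum_add_distrib, weightedMyerson, Finset.mul_sum]
  refine Finset.sum_congr rfl fun g' hg' => ?_
  obtain ⟨h1, h2⟩ := (Finset.mem_filter.1 hg').2
  have hpos := sum_players_pos hw h2
  -- The dividend of g' enters once through the marginal contribution, which accounts for the
  -- weights inside g', and again in the value of h without j's links for each j outside g'.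
  -- Together these weights exhaust the players of h.
  have hsplit : ∑ k ∈ players h, w k =
      ∑ k ∈ players g', w k + ∑ k ∈ players h, if k ∉ players g' then w k else 0 := by
    rw [← Finset.sum_filter, Finset.filter_notMem_eq_sdiff, add_comm,
      Finset.sum_sdiff (players_mono h1)]
  have h3 : ∑ j ∈ players h, w j *
      (if j ∉ players g' then w i / (∑ k ∈ players g', w k) * dividend v g' else 0) =
      (∑ k ∈ players h, if k ∉ players g' then w k else 0) *
        (w i / (∑ k ∈ players g', w k) * dividend v g') := by
    rw [Finset.sum_mul]
    refine Finset.sum_congr rfl fun j _ => ?_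
    split_ifs <;> simp
  rw [h3, hsplit]
  field_simp

/-- Efficiency of the weighted Myerson value. -/
theorem sum_weightedMyerson {w : N → ℝ} (hw : ∀ i, 0 < w i) (g : SimpleGraph N)
    {v : SimpleGraph N → ℝ} (hv : v ⊥ = 0) : ∑ i, weightedMyerson w g v i = v g := by
  classical
  rw [← sum_dividend v g]
  simp only [weightedMyerson]
  rw [Finset.sum_comm' (t' := Finset.univ.filter (fun k : SimpleGraph N => k ≤ g))
    (s' := fun k => players k) (by simp [and_comm])]
  refine Finset.sum_congr rfl fun g' _ => ?_
  rw [← Finset.sum_mul, ← Finset.sum_div]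
  -- The shares sum to one only if there are players; the empty network is harmless because its
  -- dividend is v ⊥ = 0.
  rcases eq_or_ne g' ⊥ with rfl | hne
  · rw [dividend_bot, hv, mul_zero]
  · obtain ⟨i, hi⟩ := players_nonempty hne
    rw [div_self (sum_players_pos hw hi).ne', one_mul]

/-- This is the price of acceptance for the proposer i: efficiency applies, since all players with
links left are in h and differ from i. -/
theorem sum_erase_weightedMyerson {N : Type} [Fintype N] [DecidableEq N]
    {w : N → ℝ} (hw : ∀ i, 0 < w i) (h : SimpleGraph N)
    {v : SimpleGraph N → ℝ} (hv : v ⊥ = 0) (i : N) :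
    ∑ j ∈ (players h).erase i, weightedMyerson w (h \ linksOf h i) v j =
      v (h \ linksOf h i) := by
  rw [← sum_weightedMyerson hw _ hv]
  refine Finset.sum_subset (Finset.subset_univ _) fun j _ hj => weightedMyerson_eq_zero _ _ _ ?_
  intro hj'
  refine hj (Finset.mem_erase.2 ⟨?_, players_mono sdiff_le hj'⟩)
  rintro rfl
  exact notMem_players_sdiff_linksOf h j hj'

end Networks

/-! ### Component decomposition and monotonicity of the value. -/

section Components

variable {N : Type}

/-- The links of `g` whose endpoints are reachable from `a`. -/
def componentOf (g : SimpleGraph N) (a : N) : SimpleGraph N where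
  Adj x y := g.Adj x y ∧ g.Reachable a x
  symm := ⟨fun _ _ h => ⟨h.1.symm, h.2.trans h.1.reachable⟩⟩
  loopless := ⟨fun _ h => h.1.ne rfl⟩

theorem reachable_componentOf {g : SimpleGraph N} {a x : N} (h : g.Reachable a x) :
    (componentOf g a).Reachable a x := by
  have h1 := (SimpleGraph.reachable_iff_reflTransGen a x).1 h
  induction h1 with
  | refl => exact SimpleGraph.Reachable.refl _
  | tail h2 h3 ih =>
    have h4 := (SimpleGraph.reachable_iff_reflTransGen _ _).2 h2
    exact (ih h4).trans (SimpleGraph.Adj.reachable (G := componentOf g a) ⟨h3, h4⟩)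

variable [Fintype N]

theorem isNetworkComponent_componentOf {g : SimpleGraph N} {a : N} (ha : a ∈ players g) :
    IsNetworkComponent g (componentOf g a) := by
  have hp : ∀ i ∈ players (componentOf g a), g.Reachable a i := by
    intro i hi
    obtain ⟨j, hj⟩ := mem_players.1 hi
    exact hj.2
  refine ⟨?_, fun _ _ h => h.1, ?_, ?_⟩
  · obtain ⟨j, hj⟩ := mem_players.1 ha
    exact SimpleGraph.ne_bot_iff_exists_adj.2 ⟨a, j, hj, SimpleGraph.Reachable.refl _⟩
  · intro i hi j hj
    exact (reachable_componentOf (hp i hi)).symm.trans (reachable_componentOf (hp j hj))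
  · intro i hi j hij
    exact ⟨hij, hp i hi⟩

theorem IsNetworkComponent.eq_componentOf {g h : SimpleGraph N} (hh : IsNetworkComponent g h)
    {a : N} (ha : a ∈ players h) : h = componentOf g a := by
  obtain ⟨-, hle, hconn, hmax⟩ := hh
  have hp : ∀ x, g.Reachable a x → x ∈ players h := by
    intro x hx
    have h1 := (SimpleGraph.reachable_iff_reflTransGen a x).1 hx
    clear hx
    induction h1 with
    | refl => exact ha
    | tail _ h3 ih => exact mem_players.2 ⟨_, (hmax _ ih _ h3).symm⟩
  refine le_antisymm (fun x y hxy => ⟨hle hxy, ?_⟩) fun x y hxy => hmax x (hp x hxy.2) y hxy.1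
  exact (hconn a ha x (mem_players.2 ⟨y, hxy⟩)).mono hle

theorem mem_netComponents {g h : SimpleGraph N} :
    h ∈ netComponents g ↔ IsNetworkComponent g h := by
  simp [netComponents]

/-- A nonempty connected sub-network of `g` lies in exactly one component of `g`. -/
theorem existsUnique_component_of_connected {g k : SimpleGraph N} (hkg : k ≤ g)
    (hk : IsNetworkComponent k k) : ∃! h, h ∈ netComponents g ∧ k ≤ h := by
  obtain ⟨a, ha⟩ := players_nonempty hk.1
  refine ⟨componentOf g a, ⟨mem_netComponents.2 (isNetworkComponent_componentOf
    (players_mono hkg ha)), fun x y hxy => ⟨hkg hxy, ?_⟩⟩, ?_⟩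
  · exact (hk.2.2.1 a ha x (mem_players.2 ⟨y, hxy⟩)).mono hkg
  · rintro h ⟨h1, h2⟩
    exact (mem_netComponents.1 h1).eq_componentOf (players_mono h2 ha)

-- `IsNetworkComponent k k` says that k is nonempty and connected. Such a k lies below exactly one
-- component, so swapping the sums counts each nonzero term once.
open scoped Classical in
theorem sum_le_eq_sum_netComponents (g : SimpleGraph N) (f : SimpleGraph N → ℝ)
    (hf : ∀ k ≤ g, ¬ IsNetworkComponent k k → f k = 0) :
    ∑ k ∈ Finset.univ.filter (fun k : SimpleGraph N => k ≤ g), f k =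
      ∑ h ∈ netComponents g, ∑ k ∈ Finset.univ.filter (fun k : SimpleGraph N => k ≤ h), f k := by
  rw [Finset.sum_comm' (t' := Finset.univ.filter (fun k : SimpleGraph N => k ≤ g))
    (s' := fun k => (netComponents g).filter fun h => k ≤ h)]
  · refine Finset.sum_congr rfl fun k hk => ?_
    have hkg := (Finset.mem_filter.1 hk).2
    by_cases hc : IsNetworkComponent k k
    · obtain ⟨h, hh, huniq⟩ := existsUnique_component_of_connected hkg hc
      have h1 : (netComponents g).filter (fun h => k ≤ h) = {h} := by
        ext h'
        rw [Finset.mem_filter, Finset.mem_singleton]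
        exact ⟨huniq h', fun e => e ▸ hh⟩
      rw [h1, Finset.sum_singleton]
    · rw [hf k hkg hc, Finset.sum_const_zero]
  · intro h k
    simp only [Finset.mem_filter, Finset.mem_univ, true_and]
    exact ⟨fun H => ⟨H, H.2.trans (mem_netComponents.1 H.1).2.1⟩, fun H => H.1⟩

/-- The dividends of a component additive function vanish on networks that are not connected. -/
theorem dividend_eq_zero_of_not_connected {v : SimpleGraph N → ℝ} (hv : IsComponentAdditive v)
    (g : SimpleGraph N) (hg : ¬ IsNetworkComponent g g) : dividend v g = 0 := by
  classical
  induction g using WellFoundedLT.induction with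
  | ind g ih =>
  -- The term of g is deleted so that the induction hypothesis covers all others. A disconnected g
  -- lies below none of its components, so the right side is still v g, leaving nothing for the
  -- dividend of g.
  have h1 := sum_le_eq_sum_netComponents g (fun k => if k = g then 0 else dividend v k) ?_
  · have h2 : ∑ h ∈ netComponents g, ∑ k ∈ Finset.univ.filter (fun k : SimpleGraph N => k ≤ h),
        (if k = g then 0 else dividend v k) = v g := by
      rw [hv.additive g]
      refine Finset.sum_congr rfl fun h hh => ?_
      rw [← sum_dividend v h]
      refine Finset.sum_congr rfl fun k hk => if_neg ?_
      rintro rfl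
      have h3 := mem_netComponents.1 hh
      exact hg (le_antisymm h3.2.1 (Finset.mem_filter.1 hk).2 ▸ h3)
    rw [h2] at h1
    have h3 : ∑ k ∈ Finset.univ.filter (fun k : SimpleGraph N => k ≤ g),
        (if k = g then dividend v k else 0) = dividend v g := by
      rw [Finset.sum_ite_eq' _ g, if_pos]
      simp
    have h4 : ∑ k ∈ Finset.univ.filter (fun k : SimpleGraph N => k ≤ g), dividend v k =
        ∑ k ∈ Finset.univ.filter (fun k : SimpleGraph N => k ≤ g),
          (if k = g then 0 else dividend v k) +
        ∑ k ∈ Finset.univ.filter (fun k : SimpleGraph N => k ≤ g),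
          (if k = g then dividend v k else 0) := by
      rw [← Finset.sum_add_distrib]
      refine Finset.sum_congr rfl fun k _ => ?_
      split_ifs <;> simp
    rw [sum_dividend, h1, h3] at h4
    linarith
  · intro k hk hc
    split_ifs with hkg
    · rfl
    · exact ih k (lt_of_le_of_ne hk hkg) hc

/-- Component decomposability of the weighted Myerson value. -/
theorem weightedMyerson_eq_sum_netComponents (w : N → ℝ) (g : SimpleGraph N)
    {v : SimpleGraph N → ℝ} (hv : IsComponentAdditive v) (i : N) :
    weightedMyerson w g v i = ∑ h ∈ netComponents g, weightedMyerson w h v i := by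
  classical
  simp only [weightedMyerson, ← Finset.filter_filter]
  simp only [Finset.sum_filter (fun k : SimpleGraph N => i ∈ players k)]
  refine sum_le_eq_sum_netComponents g _ fun k _ hk => ?_
  rw [dividend_eq_zero_of_not_connected hv k hk]
  simp

/-- Peel leaves off the star: the links of a leaf j form the single link ij, so zero-monotonicity at
j bounds v s below by a link value plus the value of a smaller star. -/
theorem value_star_nonneg {g : SimpleGraph N} {v : SimpleGraph N → ℝ} (hv : v ⊥ = 0)
    (hzm : IsZeroMonotonic g v) (hlink : ∀ i j, g.Adj i j → 0 ≤ v (SimpleGraph.edge i j))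
    {i : N} (s : SimpleGraph N) (hs : s ≤ g) (hstar : ∀ a b, s.Adj a b → a = i ∨ b = i) :
    0 ≤ v s := by
  induction s using WellFoundedLT.induction with
  | ind s ih =>
  rcases eq_or_ne s ⊥ with rfl | hne
  · exact hv.ge
  · obtain ⟨j, hj⟩ : ∃ j, s.Adj i j := by
      obtain ⟨a, b, hab⟩ := SimpleGraph.ne_bot_iff_exists_adj.1 hne
      rcases hstar a b hab with rfl | rfl
      · exact ⟨b, hab⟩
      · exact ⟨a, hab.symm⟩
    have h1 : linksOf s j = SimpleGraph.edge i j := by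
      ext a b
      rw [SimpleGraph.edge_adj]
      constructor
      · rintro ⟨h2, h3⟩
        refine ⟨?_, h2.ne⟩
        have h4 := h2.ne
        have h5 := hj.ne
        rcases hstar a b h2 with rfl | rfl <;> rcases h3 with rfl | rfl <;> simp_all
      · rintro ⟨⟨rfl, rfl⟩ | ⟨rfl, rfl⟩, -⟩
        · exact ⟨hj, Or.inr rfl⟩
        · exact ⟨hj.symm, Or.inl rfl⟩
    have hjs : j ∈ players s := mem_players.2 ⟨i, hj.symm⟩
    have h2 := hzm s hs j hjs
    have h3 := ih (s \ linksOf s j) (lt_of_le_of_ne sdiff_le fun h => by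
      have h4 := notMem_players_sdiff_linksOf s j
      rw [h] at h4
      exact h4 hjs) (sdiff_le.trans hs) fun a b hab => hstar a b hab.1
    have h4 := hlink i j (hs hj)
    rw [h1] at h2 h3
    linarith

/-- A player never lowers the value of a network by his links. -/
theorem value_sdiff_linksOf_le {g : SimpleGraph N} {v : SimpleGraph N → ℝ} (hv : v ⊥ = 0)
    (hzm : IsZeroMonotonic g v) (hlink : ∀ i j, g.Adj i j → 0 ≤ v (SimpleGraph.edge i j))
    {h : SimpleGraph N} (hh : h ≤ g) {i : N} (hi : i ∈ players h) :
    v (h \ linksOf h i) ≤ v h := by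
  have h1 := hzm h hh i hi
  have h2 := value_star_nonneg hv hzm hlink (i := i) (linksOf h i)
    (fun _ _ hab => hh hab.1) fun _ _ hab => hab.2
  linarith

end Components

/-! ### Games with determined equilibrium payoffs. -/

namespace ExtGame

variable {N : Type}

/-- The expected payoffs under `σ`, and all payoff vectors that occur with positive probability,
are equal to `c`. -/
def PaysSurely (G : ExtGame N) (σ : Profile G) (c : N → ℝ) : Prop :=
  payoff G σ = c ∧ ∀ x ∈ outcomes G σ, x = c

theorem PaysSurely.of_eq {G : ExtGame N} {σ : Profile G} {a b : N → ℝ} (h : PaysSurely G σ a)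
    (e : a = b) : PaysSurely G σ b := e ▸ h

/-- Every subgame perfect equilibrium of `G` surely pays `c`. -/
def Determined (G : ExtGame N) (c : N → ℝ) : Prop :=
  ∀ σ : Profile G, IsSubgamePerfect G σ → PaysSurely G σ c

theorem determined_terminal (u : N → ℝ) : Determined (terminal u) u :=
  fun _ _ => ⟨rfl, fun _ hx => hx⟩

theorem Determined.transfer {G : ExtGame N} {c : N → ℝ} (hG : Determined G c) (t : N → ℝ) :
    Determined (transfer t G) fun i => t i + c i := by
  intro σ hσ
  obtain ⟨h1, h2⟩ := hG σ.afterTransfer hσ.2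
  refine ⟨?_, ?_⟩
  · funext i
    show t i + payoff G σ.afterTransfer i = _
    rw [h1]
  · rintro x ⟨y, hy, rfl⟩
    rw [h2 y hy]

theorem determined_parallel {κ : Type} [fin : Fintype κ] {G : κ → ExtGame N} {c : κ → N → ℝ}
    (hG : ∀ k, Determined (G k) (c k)) :
    Determined (parallel κ fin G) fun i => ∑ k, c k i := by
  intro σ hσ
  refine ⟨?_, ?_⟩
  · funext i
    show ∑ k, payoff (G k) (σ.inParallel k) i = _
    exact Finset.sum_congr rfl fun k _ => congrFun (hG k _ (hσ.2 k)).1 i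
  · rintro x ⟨y, hy, rfl⟩
    funext i
    exact Finset.sum_congr rfl fun k _ => congrFun ((hG k _ (hσ.2 k)).2 _ (hy k)) i

/-- If all continuations have the determined payoffs `c`, then so has the move. -/
theorem determined_move_of_forall {S : Finset N} {A : N → Type} {next : ((i : S) → A i) → ExtGame N}
    {c : N → ℝ} (h : ∀ a, Determined (next a) c) : Determined (move S A next) c := by
  intro σ hσ
  exact h _ _ (hσ.2 σ.actions)

open scoped Classical in
/-- A player cannot gain by changing only his action at an initial move. -/
theorem IsNash.payoff_update_actions_le {S : Finset N} [DecidableEq S] {A : N → Type}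
    {next : ((i : S) → A i) → ExtGame N} {σ : Profile (move S A next)}
    (hσ : IsNash (move S A next) σ) (i : S) (x : A i) :
    payoff (next (Function.update σ.actions i x)) (σ.afterMove (Function.update σ.actions i x)) i ≤
      payoff (next σ.actions) (σ.afterMove σ.actions) i := by
  -- The deviation plays x at the root and keeps the old behaviour in every continuation.
  let s : Strategy i.1 (move S A next) := (fun _ => x, (σ i.1).2)
  suffices key : ∀ σ' : Profile (move S A next), σ' i.1 = s → (∀ j, j ≠ i.1 → σ' j = σ j) →
      payoff (move S A next) σ' i ≤ payoff (next σ.actions) (σ.afterMove σ.actions) i →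
      payoff (next (Function.update σ.actions i x))
        (σ.afterMove (Function.update σ.actions i x)) i ≤
      payoff (next σ.actions) (σ.afterMove σ.actions) i from
    key (Function.update σ i.1 s) (Function.update_self i.1 s σ)
      (fun j hj => Function.update_of_ne hj s σ) (hσ i s)
  intro σ' hself hne h1
  have h2 : σ'.actions = Function.update σ.actions i x := by
    funext j
    by_cases hj : j = i
    · subst hj
      rw [Function.update_self]
      show (σ' j.1).1 j.2 = x
      rw [hself]
    · rw [Function.update_of_ne hj]
      show (σ' j.1).1 j.2 = (σ j.1).1 j.2
      rw [hne j.1 fun e => hj (Subtype.ext e)]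
  have h3 : ∀ a, σ'.afterMove a = σ.afterMove a := by
    intro a
    funext j
    show (σ' j).2 a = (σ j).2 a
    by_cases hj : j = i.1
    · subst hj
      rw [hself]
    · rw [hne j hj]
  have h4 : payoff (move S A next) σ' = payoff (next σ'.actions) (σ.afterMove σ'.actions) := by
    rw [← h3]; rfl
  rw [h4, h2] at h1
  exact h1

end ExtGame

/-! ### Responses and the offer of the proposer. -/

section OfferStage

open ExtGame

variable {N : Type}

/-- After one rejection the later responses have no effect. -/
theorem determined_respond_false {next : Bool → ExtGame N} {c : N → ℝ}
    (h : Determined (next false) c) : ∀ l, Determined (respond next l false) c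
  | [] => h
  | _ :: l => determined_move_of_forall fun _ => determined_respond_false h l

/-- In equilibrium an offer is either accepted, and then nobody would be better off by rejecting
it, or rejected. -/
theorem respond_true_cases {next : Bool → ExtGame N} {a c : N → ℝ}
    (ht : Determined (next true) a) (hf : Determined (next false) c) :
    ∀ (l : List N) (σ : Profile (respond next l true)),
      IsSubgamePerfect (respond next l true) σ →
      (PaysSurely (respond next l true) σ a ∧ ∀ j ∈ l, c j ≤ a j) ∨
        PaysSurely (respond next l true) σ c
  | [], σ, hσ => Or.inl ⟨ht σ hσ, by simp⟩
  | j :: l, σ, hσ => by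
    -- The decision occurs in the type of the continuation profile; an arbitrary b with an equation
    -- can be substituted there.
    have hT : ∀ b, b = true → ∀ τ : Profile (respond next l (true && b)),
        IsSubgamePerfect (respond next l (true && b)) τ →
        (PaysSurely (respond next l (true && b)) τ a ∧ ∀ j ∈ l, c j ≤ a j) ∨
          PaysSurely (respond next l (true && b)) τ c := by
      rintro _ rfl τ hτ
      exact respond_true_cases ht hf l τ hτ
    have hF : ∀ b, b = false → Determined (respond next l (true && b)) c := by
      rintro _ rfl
      exact determined_respond_false hf l
    classical
    obtain ⟨hN, hS⟩ := hσ
    cases hd : σ.actions ⟨j, Finset.mem_singleton_self j⟩ with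
    | false => exact Or.inr (hF _ hd _ (hS σ.actions))
    | true =>
      rcases hT _ hd _ (hS σ.actions) with ⟨h1, h2⟩ | h1
      · refine Or.inl ⟨h1, ?_⟩
        intro k hk
        rcases List.mem_cons.1 hk with rfl | hk
        · have h3 := hN.payoff_update_actions_le ⟨k, Finset.mem_singleton_self k⟩ false
          have h4 := (hF _ (Function.update_self _ _ _) _
            (hS (Function.update σ.actions ⟨k, Finset.mem_singleton_self k⟩ false))).1
          rw [h1.1] at h3
          exact (congrFun h4 k).symm.trans_le h3
        · exact h2 k hk
      · exact Or.inr h1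

/-- An offer that everybody strictly prefers to the consequences of a rejection is accepted. -/
theorem respond_true_of_forall_lt {next : Bool → ExtGame N} {a c : N → ℝ}
    (ht : Determined (next true) a) (hf : Determined (next false) c) :
    ∀ l : List N, (∀ j ∈ l, c j < a j) → Determined (respond next l true) a
  | [], _ => ht
  | j :: l, hl => by
    classical
    rintro σ ⟨hN, hS⟩
    have hT : ∀ b, b = true → Determined (respond next l (true && b)) a := by
      rintro _ rfl
      exact respond_true_of_forall_lt ht hf l fun k hk => hl k (List.mem_cons_of_mem _ hk)
    have hF : ∀ b, b = false → Determined (respond next l (true && b)) c := by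
      rintro _ rfl
      exact determined_respond_false hf l
    cases hd : σ.actions ⟨j, Finset.mem_singleton_self j⟩ with
    | true => exact hT _ hd _ (hS σ.actions)
    | false =>
      exfalso
      have h1 := (hF _ hd _ (hS σ.actions)).1
      have h3 := hN.payoff_update_actions_le ⟨j, Finset.mem_singleton_self j⟩ true
      have h4 := (hT _ (Function.update_self _ _ _) _
        (hS (Function.update σ.actions ⟨j, Finset.mem_singleton_self j⟩ true))).1
      rw [h1] at h3
      have h5 := (congrFun h4 j).symm.trans_le h3
      exact absurd (hl j List.mem_cons_self) (not_lt.2 h5)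

variable [Fintype N] [LinearOrder N]

theorem acceptPayoffs_of_mem (v : SimpleGraph N → ℝ) (h : SimpleGraph N) (i : N)
    (y : Promise h i) {j : N} (hj : j ∈ (players h).erase i) :
    acceptPayoffs v h i y j = y ⟨j, hj⟩ := dif_pos hj

theorem acceptPayoffs_self (v : SimpleGraph N → ℝ) (h : SimpleGraph N) (i : N)
    (y : Promise h i) : acceptPayoffs v h i y i = v h - ∑ k, y k := by
  simp [acceptPayoffs]

theorem acceptPayoffs_of_notMem (v : SimpleGraph N → ℝ) (h : SimpleGraph N) (i : N)
    (y : Promise h i) {j : N} (hj : j ∉ (players h).erase i) (hji : j ≠ i) :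
    acceptPayoffs v h i y j = 0 := by
  rw [acceptPayoffs, dif_neg hj, if_neg hji]

/-- The payoffs after the bids have been paid, when `i` is the proposer and `c` are the payoffs
after a rejection: the proposer extracts the whole surplus. -/
noncomputable def proposerPayoffs (v : SimpleGraph N → ℝ) (h : SimpleGraph N) (c : N → ℝ)
    (i : N) : N → ℝ :=
  fun j => if j = i then v h - ∑ k ∈ (players h).erase i, c k else c j

/-- Offers slightly above c bound the proposer's payoff from below, and the responders' option to
reject bounds it from above. The hypothesis `hle` matters only after a rejection, where it forces
the surplus to be zero. -/
theorem determined_offer (v : SimpleGraph N → ℝ) (h : SimpleGraph N) (i : N) {G : ExtGame N}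
    {c : N → ℝ} (hG : Determined G c) (hci : c i = 0) (hc : ∀ j ∉ players h, c j = 0)
    (hle : ∑ j ∈ (players h).erase i, c j ≤ v h) :
    Determined (ExtGame.move {i} (fun k => Promise h k) fun y =>
      respond
        (fun acc => if acc = true
          then ExtGame.terminal (acceptPayoffs v h i (y ⟨i, Finset.mem_singleton_self i⟩))
          else G)
        (((players h).erase i).sort (· ≤ ·)) true)
      (proposerPayoffs v h c i) := by
  rintro σ ⟨hN, hS⟩
  set i' : ({i} : Finset N) := ⟨i, Finset.mem_singleton_self i⟩ with hi'
  have hnt : ∀ y : Promise h i, Determined ((fun acc => if acc = true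
          then ExtGame.terminal (acceptPayoffs v h i y) else G) true) (acceptPayoffs v h i y) :=
    fun y => determined_terminal _
  have hnf : ∀ y : Promise h i, Determined ((fun acc => if acc = true
          then ExtGame.terminal (acceptPayoffs v h i y) else G) false) c := fun y => hG
  -- Offer c + δ to everyone and let δ tend to zero.
  have hlow : v h - ∑ j ∈ (players h).erase i, c j ≤ payoff _ (σ.afterMove σ.actions) i := by
    have hn : 0 ≤ (((players h).erase i).card : ℝ) := Nat.cast_nonneg _
    refine le_of_forall_pos_lt_add fun ε hε => ?_
    obtain ⟨δ, hδ, hδε⟩ : ∃ δ > 0, (((players h).erase i).card : ℝ) * δ < ε := by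
      refine ⟨ε / (((players h).erase i).card + 1), by positivity, ?_⟩
      rw [mul_div_assoc', div_lt_iff₀ (by positivity)]
      nlinarith
    have h1 := hN.payoff_update_actions_le i' (fun k : {j // j ∈ (players h).erase i} => c k + δ)
    have hy : Function.update σ.actions i' (fun k : {j // j ∈ (players h).erase i} => c k + δ) i' =
      (fun k : {j // j ∈ (players h).erase i} => c k + δ) := Function.update_self _ _ _
    have h2 : Determined (respond (fun acc => if acc = true
        then ExtGame.terminal (acceptPayoffs v h i (Function.update σ.actions i'
          (fun k : {j // j ∈ (players h).erase i} => c k + δ) i')) else G)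
        (((players h).erase i).sort (· ≤ ·)) true)
        (acceptPayoffs v h i (fun k : {j // j ∈ (players h).erase i} => c k + δ)) := by
      rw [hy]
      refine respond_true_of_forall_lt (hnt _) (hnf _) _ fun j hj => ?_
      rw [acceptPayoffs_of_mem _ _ _ _ ((Finset.mem_sort _).1 hj)]
      exact lt_add_of_pos_right _ hδ
    have h3 := congrFun (h2 _ (hS _)).1 i
    rw [acceptPayoffs_self, Finset.sum_coe_sort _ (fun k => c k + δ), Finset.sum_add_distrib,
      Finset.sum_const, nsmul_eq_mul] at h3
    have h4 := h3.symm.trans_le h1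
    linarith
  show PaysSurely _ (σ.afterMove σ.actions) _
  rcases respond_true_cases (hnt (σ.actions i')) (hnf (σ.actions i')) _ _ (hS σ.actions) with
    ⟨h1, h2⟩ | h1
  -- Accepted: each offer is at least c, while `hlow` bounds their total by that of c, so all are
  -- equal to c.
  · suffices h3 : acceptPayoffs v h i (σ.actions i') = proposerPayoffs v h c i from h1.of_eq h3
    rw [h1.1, acceptPayoffs_self] at hlow
    have h4 : ∀ k ∈ (Finset.univ : Finset {j // j ∈ (players h).erase i}),
        c k ≤ σ.actions i' k := by
      intro k _
      have h5 := h2 k ((Finset.mem_sort _).2 k.2)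
      rwa [acceptPayoffs_of_mem _ _ _ _ k.2] at h5
    have h6 : ∑ k : {j // j ∈ (players h).erase i}, c k = ∑ j ∈ (players h).erase i, c j :=
      Finset.sum_coe_sort _ c
    have h7 : ∑ k : {j // j ∈ (players h).erase i}, c k =
        ∑ k : {j // j ∈ (players h).erase i}, σ.actions i' k :=
      le_antisymm (Finset.sum_le_sum h4) (by rw [h6]; linarith)
    have h8 := (Finset.sum_eq_sum_iff_of_le h4).1 h7
    funext j
    by_cases hj : j ∈ (players h).erase i
    · rw [acceptPayoffs_of_mem _ _ _ _ hj, proposerPayoffs, if_neg (Finset.ne_of_mem_erase hj)]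
      exact (h8 ⟨j, hj⟩ (Finset.mem_univ _)).symm
    · by_cases hji : j = i
      · subst hji
        rw [acceptPayoffs_self, proposerPayoffs, if_pos rfl, ← h6, h7]
      · rw [acceptPayoffs_of_notMem _ _ _ _ hj hji, proposerPayoffs, if_neg hji]
        exact (hc j fun hj' => hj (Finset.mem_erase.2 ⟨hji, hj'⟩)).symm
  -- Rejected: the proposer gets c i = 0, so `hlow` and `hle` leave no surplus.
  · suffices h3 : proposerPayoffs v h c i = c from h1.of_eq h3.symm
    rw [h1.1, hci] at hlow
    funext j
    by_cases hji : j = i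
    · subst hji
      rw [proposerPayoffs, if_pos rfl, hci]
      linarith
    · rw [proposerPayoffs, if_neg hji]

end OfferStage

/-! ### Equilibrium of the bidding stage. -/

section BiddingStage

variable {N : Type} [Fintype N] [LinearOrder N]

theorem netBid_update_self (w : N → ℝ) (h : SimpleGraph N) (b : N → N → ℝ) (i : N) (δ : N → ℝ) :
    netBid w h (Function.update b i (b i + δ)) i =
      netBid w h b i + w i * ∑ j ∈ (players h).erase i, δ j := by
  have h1 : ∑ j ∈ (players h).erase i, w j * Function.update b i (b i + δ) j i =
      ∑ j ∈ (players h).erase i, w j * b j i :=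
    Finset.sum_congr rfl fun j hj => by rw [Function.update_of_ne (Finset.ne_of_mem_erase hj)]
  rw [netBid, netBid, h1, Function.update_self]
  simp only [Pi.add_apply, mul_add, Finset.sum_add_distrib, ← Finset.mul_sum]
  ring

theorem netBid_update_of_ne (w : N → ℝ) {h : SimpleGraph N} (b : N → N → ℝ) {i k : N}
    (hi : i ∈ players h) (hki : k ≠ i) (δ : N → ℝ) :
    netBid w h (Function.update b i (b i + δ)) k = netBid w h b k - w i * δ k := by
  have h1 : ∑ j ∈ (players h).erase k, w j * Function.update b i (b i + δ) j k =
      ∑ j ∈ (players h).erase k, (w j * b j k + if j = i then w i * δ k else 0) := by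
    refine Finset.sum_congr rfl fun j _ => ?_
    split_ifs with hj
    · subst hj
      rw [Function.update_self, Pi.add_apply, mul_add]
    · rw [Function.update_of_ne hj, add_zero]
  rw [netBid, netBid, h1, Function.update_of_ne hki, Finset.sum_add_distrib, Finset.sum_ite_eq',
    if_pos (Finset.mem_erase.2 ⟨hki.symm, hi⟩)]
  ring

theorem sum_netBid (w : N → ℝ) (h : SimpleGraph N) (b : N → N → ℝ) :
    ∑ i ∈ players h, netBid w h b i = 0 := by
  simp only [netBid, Finset.sum_sub_distrib]
  rw [sub_eq_zero]
  refine Finset.sum_comm' fun x y => ?_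
  simp only [Finset.mem_erase]
  tauto

theorem mem_topBidders {w : N → ℝ} {h : SimpleGraph N} {b : N → N → ℝ} {i : N} :
    i ∈ topBidders w h b ↔ i ∈ players h ∧ ∀ j ∈ players h, netBid w h b j ≤ netBid w h b i :=
  Finset.mem_filter

theorem topBidders_nonempty (w : N → ℝ) {h : SimpleGraph N} (hh : (players h).Nonempty)
    (b : N → N → ℝ) : (topBidders w h b).Nonempty := by
  obtain ⟨i, hi, hmax⟩ := Finset.exists_max_image (players h) (netBid w h b) hh
  exact ⟨i, mem_topBidders.2 ⟨hi, hmax⟩⟩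

/-- A set of players with equal net bids that exceed all other net bids is the set of top
bidders. -/
theorem topBidders_eq_of {w : N → ℝ} {h : SimpleGraph N} {b : N → N → ℝ} {W : Finset N} {M : ℝ}
    (hne : W.Nonempty) (hW : W ⊆ players h) (heq : ∀ i ∈ W, netBid w h b i = M)
    (hlt : ∀ i ∈ players h, i ∉ W → netBid w h b i < M) : topBidders w h b = W := by
  ext i
  rw [mem_topBidders]
  constructor
  · rintro ⟨hi, hmax⟩
    by_contra hiW
    obtain ⟨k, hk⟩ := hne
    have h1 := hmax k (hW hk)
    rw [heq k hk] at h1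
    exact absurd (hlt i hi hiW) (not_lt.2 h1)
  · intro hi
    refine ⟨hW hi, fun j hj => ?_⟩
    rw [heq i hi]
    by_cases hjW : j ∈ W
    · exact (heq j hjW).le
    · exact (hlt j hj hjW).le

/-- The total payoff of `i` if `k` is the proposer and `D k` are the payoffs after the payment of
the bids. -/
noncomputable def proposalPayoff (h : SimpleGraph N) (b D : N → N → ℝ) (k i : N) : ℝ :=
  bidPayments h b k i + D k i

/-- The expected payoff of `i` in the bidding stage. -/
noncomputable def expectedPayoff (w : N → ℝ) (h : SimpleGraph N) (b D : N → N → ℝ) (i : N) : ℝ :=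
  (∑ k ∈ topBidders w h b, proposalPayoff h b D k i) / ((topBidders w h b).card : ℝ)

theorem proposalPayoff_update_self (h : SimpleGraph N) (b D : N → N → ℝ) (i : N) (δ : N → ℝ) :
    proposalPayoff h (Function.update b i (b i + δ)) D i i =
      proposalPayoff h b D i i - ∑ j ∈ (players h).erase i, δ j := by
  simp only [proposalPayoff, bidPayments, if_true, Function.update_self, Pi.add_apply,
    Finset.sum_add_distrib]
  ring

theorem proposalPayoff_update_of_ne (h : SimpleGraph N) (b D : N → N → ℝ) {i k : N}
    (hki : k ≠ i) (δ : N → ℝ) :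
    proposalPayoff h (Function.update b i (b i + δ)) D k i = proposalPayoff h b D k i := by
  simp only [proposalPayoff, bidPayments, if_neg hki.symm, Function.update_of_ne hki]

/-- No player of `h` gains in the bidding stage by changing his bids. -/
def IsBiddingEquilibrium (w : N → ℝ) (h : SimpleGraph N) (D b : N → N → ℝ) : Prop :=
  ∀ i ∈ players h, ∀ δ : N → ℝ, (∀ j ∉ (players h).erase i, δ j = 0) →
    expectedPayoff w h (Function.update b i (b i + δ)) D i ≤ expectedPayoff w h b D i

/-- In equilibrium everybody is a top bidder: otherwise a top bidder could lower his total bid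
without changing the set of top bidders. -/
theorem IsBiddingEquilibrium.topBidders_eq {w : N → ℝ} (hw : ∀ i, 0 < w i) {h : SimpleGraph N}
    (hh : (players h).Nonempty) {D b : N → N → ℝ} (hb : IsBiddingEquilibrium w h D b) :
    topBidders w h b = players h := by
  by_contra hne
  set W := topBidders w h b with hWdef
  have hWP : W ⊆ players h := Finset.filter_subset _ _
  have hWne : W.Nonempty := topBidders_nonempty w hh b
  obtain ⟨j, hj, hjmax⟩ := Finset.exists_max_image (players h \ W) (netBid w h b)
    (Finset.sdiff_nonempty.2 fun hs => hne (le_antisymm hWP hs))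
  obtain ⟨hjP, hjW⟩ := Finset.mem_sdiff.1 hj
  obtain ⟨i, hi⟩ := hWne
  have hiP := hWP hi
  have hij : i ≠ j := fun e => hjW (e ▸ hi)
  have hM : ∀ k ∈ W, netBid w h b k = netBid w h b i := fun k hk =>
    le_antisymm ((mem_topBidders.1 hi).2 k (hWP hk)) ((mem_topBidders.1 hk).2 i hiP)
  have hgap : netBid w h b j < netBid w h b i := by
    by_contra hcon
    refine hjW (mem_topBidders.2 ⟨hjP, fun k hk => ?_⟩)
    exact ((mem_topBidders.1 hi).2 k hk).trans (not_lt.1 hcon)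
  have hcard : 0 < (W.card : ℝ) := Nat.cast_pos.2 (Finset.card_pos.2 ⟨i, hi⟩)
  have hwi := hw i
  obtain ⟨t, ht, htgap⟩ : ∃ t > 0,
      netBid w h b j + w i * (W.card * t) < netBid w h b i - w i * t := by
    refine ⟨(netBid w h b i - netBid w h b j) / (2 * (w i * (W.card + 1))),
      div_pos (sub_pos.2 hgap) (by positivity), ?_⟩
    have h1 : w i * (W.card + 1) *
        ((netBid w h b i - netBid w h b j) / (2 * (w i * (W.card + 1)))) =
        (netBid w h b i - netBid w h b j) / 2 := by
      field_simp
    nlinarith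
  -- The top bidder i raises his bids to the other top bidders by t and cuts the bid to j by |W| t,
  -- a total change of -t. All net bids in W then fall by w i * t, and the choice of t keeps j below
  -- them.
  set δ : N → ℝ := fun k => (if k ∈ W.erase i then t else 0) + if k = j then -(W.card * t) else 0
    with hδ
  have hδW : ∀ k ∈ W, k ≠ i → δ k = t := by
    intro k hk hki
    have hkj : k ≠ j := fun e => hjW (e ▸ hk)
    simp [hδ, hk, hki, hkj]
  have hδj : δ j = -(W.card * t) := by
    simp [hδ, hjW]
  have hδo : ∀ k ∉ W, k ≠ j → δ k = 0 := by
    intro k hk hkj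
    simp [hδ, hk, hkj]
  have hδi : δ i = 0 := by
    simp [hδ, hij]
  have hsum : ∑ k ∈ (players h).erase i, δ k = -t := by
    rw [hδ, Finset.sum_add_distrib, Finset.sum_ite_eq',
      if_pos (Finset.mem_erase.2 ⟨hij.symm, hjP⟩), Finset.sum_ite_mem,
      Finset.inter_eq_right.2 (Finset.erase_subset_erase i hWP), Finset.sum_const,
      Finset.card_erase_of_mem hi, nsmul_eq_mul, Nat.cast_sub (Finset.card_pos.2 ⟨i, hi⟩)]
    push_cast
    ring
  have hdev := hb i hiP δ fun k hk => by
    by_cases hki : k = i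
    · rw [hki, hδi]
    · have hkP : k ∉ players h := fun hkP => hk (Finset.mem_erase.2 ⟨hki, hkP⟩)
      exact hδo k (fun hkW => hkP (hWP hkW)) fun e => hkP (e ▸ hjP)
  have htop : topBidders w h (Function.update b i (b i + δ)) = W := by
    refine topBidders_eq_of (M := netBid w h b i - w i * t) ⟨i, hi⟩ hWP ?_ ?_
    · intro k hk
      by_cases hki : k = i
      · subst hki
        rw [netBid_update_self, hsum]
        ring
      · rw [netBid_update_of_ne w b hiP hki, hM k hk, hδW k hk hki]
    · intro k hkP hkW
      have hki : k ≠ i := fun e => hkW (e ▸ hi)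
      rw [netBid_update_of_ne w b hiP hki]
      by_cases hkj : k = j
      · rw [hkj, hδj]
        linarith
      · rw [hδo k hkW hkj]
        have h1 := hjmax k (Finset.mem_sdiff.2 ⟨hkP, hkW⟩)
        have h2 : 0 ≤ w i * (W.card * t) := by positivity
        linarith
  have hgain : ∑ k ∈ W, proposalPayoff h (Function.update b i (b i + δ)) D k i =
      ∑ k ∈ W, proposalPayoff h b D k i + t := by
    rw [← Finset.add_sum_erase _ _ hi, ← Finset.add_sum_erase _ _ hi, proposalPayoff_update_self,
      hsum, Finset.sum_congr rfl fun k hk =>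
        proposalPayoff_update_of_ne h b D (Finset.ne_of_mem_erase hk) δ]
    ring
  rw [expectedPayoff, expectedPayoff, htop, ← hWdef, hgain,
    div_le_div_iff_of_pos_right hcard] at hdev
  linarith

/-- In equilibrium everybody is indifferent as to who becomes the proposer. -/
theorem IsBiddingEquilibrium.proposalPayoff_eq {w : N → ℝ} (hw : ∀ i, 0 < w i)
    {h : SimpleGraph N} {D b : N → N → ℝ} (hb : IsBiddingEquilibrium w h D b) {i k : N}
    (hi : i ∈ players h) (hk : k ∈ players h) :
    proposalPayoff h b D k i = expectedPayoff w h b D i := by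
  have htop := hb.topBidders_eq hw ⟨i, hi⟩
  have hwi := hw i
  have heq : ∀ k ∈ players h, ∀ l ∈ players h, netBid w h b k = netBid w h b l := by
    intro k hk l hl
    rw [← htop] at hk hl
    exact le_antisymm ((mem_topBidders.1 hl).2 k (mem_topBidders.1 hk).1)
      ((mem_topBidders.1 hk).2 l (mem_topBidders.1 hl).1)
  have hle : ∀ k ∈ players h, proposalPayoff h b D k i ≤ expectedPayoff w h b D i := by
    intro k hk
    by_cases hki : k = i
    · subst hki
      -- Raising all his bids by a small t makes the player the sole proposer at negligible cost.
      refine le_of_forall_pos_lt_add fun ε hε => ?_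
      obtain ⟨t, ht, htε⟩ : ∃ t > 0, (((players h).erase k).card : ℝ) * t < ε := by
        refine ⟨ε / (((players h).erase k).card + 1), by positivity, ?_⟩
        rw [mul_div_assoc', div_lt_iff₀ (by positivity)]
        nlinarith
      set δ : N → ℝ := fun j => if j ∈ (players h).erase k then t else 0 with hδ
      have hsum : ∑ j ∈ (players h).erase k, δ j = ((players h).erase k).card * t := by
        rw [Finset.sum_congr rfl fun j hj => if_pos hj, Finset.sum_const, nsmul_eq_mul]
      have hdev := hb k hk δ fun j hj => if_neg hj
      have htop' : topBidders w h (Function.update b k (b k + δ)) = {k} := by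
        refine topBidders_eq_of (M := netBid w h b k + w k * (((players h).erase k).card * t))
          (Finset.singleton_nonempty k) (Finset.singleton_subset_iff.2 hk) ?_ ?_
        · intro j hj
          rw [Finset.mem_singleton.1 hj, netBid_update_self, hsum]
        · intro j hj hjk
          rw [Finset.mem_singleton] at hjk
          rw [netBid_update_of_ne w b hk hjk, heq j hj k hk,
            show δ j = t from if_pos (Finset.mem_erase.2 ⟨hjk, hj⟩)]
          have h1 : 0 ≤ w k * (((players h).erase k).card * t) := by positivity
          have h2 : 0 < w k * t := by positivity
          linarith
      rw [expectedPayoff, htop', Finset.sum_singleton, proposalPayoff_update_self, hsum,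
        Finset.card_singleton, Nat.cast_one, div_one] at hdev
      linarith
    -- Cutting only the bid to k makes k the sole top bidder; this costs i nothing, since i does not
    -- pay his bids.
    · set δ : N → ℝ := fun j => if j = k then -1 else 0 with hδ
      have hkm : k ∈ (players h).erase i := Finset.mem_erase.2 ⟨hki, hk⟩
      have hsum : ∑ j ∈ (players h).erase i, δ j = -1 := by
        rw [hδ, Finset.sum_ite_eq', if_pos hkm]
      have hdev := hb i hi δ fun j hj => if_neg fun e : j = k => hj (e.symm ▸ hkm)
      have htop' : topBidders w h (Function.update b i (b i + δ)) = {k} := by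
        refine topBidders_eq_of (M := netBid w h b k + w i)
          (Finset.singleton_nonempty k) (Finset.singleton_subset_iff.2 hk) ?_ ?_
        · intro j hj
          rw [Finset.mem_singleton.1 hj, netBid_update_of_ne w b hi hki, hδ]
          simp
        · intro j hj hjk
          rw [Finset.mem_singleton] at hjk
          by_cases hji : j = i
          · rw [hji, netBid_update_self, hsum, heq i hi k hk]
            linarith
          · rw [netBid_update_of_ne w b hi hji, heq j hj k hk,
              show δ j = 0 from if_neg hjk]
            linarith
      rw [expectedPayoff, htop', Finset.sum_singleton, proposalPayoff_update_of_ne h b D hki,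
        Finset.card_singleton, Nat.cast_one, div_one] at hdev
      exact hdev
  have hcard : 0 < ((players h).card : ℝ) := Nat.cast_pos.2 (Finset.card_pos.2 ⟨i, hi⟩)
  -- No term exceeds the average of the terms, so all are equal to it.
  refine (Finset.sum_eq_sum_iff_of_le hle).1 ?_ k hk
  rw [Finset.sum_const, nsmul_eq_mul]
  conv_rhs => rw [expectedPayoff, htop]
  field_simp

/-- The equilibrium payoffs of the bidding stage. -/
theorem IsBiddingEquilibrium.weighted_payoff_eq {w : N → ℝ} (hw : ∀ i, 0 < w i)
    {h : SimpleGraph N} {D b : N → N → ℝ} (hb : IsBiddingEquilibrium w h D b) {i k : N}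
    (hi : i ∈ players h) (hk : k ∈ players h) :
    (∑ j ∈ players h, w j) * proposalPayoff h b D k i = ∑ j ∈ players h, w j * D j i := by
  have htop := hb.topBidders_eq hw ⟨i, hi⟩
  have hzero : netBid w h b i = 0 := by
    have h1 : ∑ j ∈ players h, netBid w h b j = (players h).card * netBid w h b i := by
      rw [← nsmul_eq_mul, ← Finset.sum_const]
      refine Finset.sum_congr rfl fun j hj => ?_
      rw [← htop] at hj hi
      exact le_antisymm ((mem_topBidders.1 hi).2 j (mem_topBidders.1 hj).1)
        ((mem_topBidders.1 hj).2 i (mem_topBidders.1 hi).1)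
    rw [sum_netBid] at h1
    rcases mul_eq_zero.1 h1.symm with h2 | h2
    · exact absurd (Finset.card_pos.2 ⟨i, hi⟩) (by rw [Nat.cast_eq_zero.1 h2]; exact lt_irrefl 0)
    · exact h2
  have h1 : (∑ j ∈ players h, w j) * proposalPayoff h b D k i =
      ∑ j ∈ players h, w j * proposalPayoff h b D j i := by
    rw [Finset.sum_mul]
    refine Finset.sum_congr rfl fun j hj => ?_
    rw [hb.proposalPayoff_eq hw hi hk, hb.proposalPayoff_eq hw hi hj]
  -- This weighted sum is minus the net bid of i.
  have h2 : ∑ j ∈ players h, w j * bidPayments h b j i = 0 := by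
    rw [← neg_eq_zero, ← hzero, ← Finset.add_sum_erase _ _ hi, netBid]
    have h3 : ∑ j ∈ (players h).erase i, w j * bidPayments h b j i =
        ∑ j ∈ (players h).erase i, w j * b j i :=
      Finset.sum_congr rfl fun j hj => by
        rw [bidPayments, if_neg (Finset.ne_of_mem_erase hj).symm]
    rw [h3, bidPayments, if_pos rfl, ← Finset.mul_sum]
    ring
  rw [h1]
  simp only [proposalPayoff, mul_add, Finset.sum_add_distrib]
  rw [h2, zero_add]

end BiddingStage

/-! ### From one round to the whole mechanism. -/

section Equilibrium

open ExtGame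

variable {N : Type} [Fintype N] [LinearOrder N]

theorem bidOf_eq_zero_of_notMem (h : SimpleGraph N) (β : (i : players h) → Promise h i) (i : N)
    {j : N} (hj : j ∉ (players h).erase i) : bidOf h β i j = 0 := by
  by_cases hi : i ∈ players h
  · rw [bidOf, dif_pos hi, dif_neg hj]
  · rw [bidOf, dif_neg hi]

/-- It turns perturbations of the bid matrix into deviations in the game. -/
theorem bidOf_update (h : SimpleGraph N) (β : (i : players h) → Promise h i) (i : players h)
    (δ : N → ℝ) (hδ : ∀ j ∉ (players h).erase i, δ j = 0) :
    bidOf h (Function.update β i fun k => bidOf h β i k + δ k) =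
      Function.update (bidOf h β) i.1 (bidOf h β i.1 + δ) := by
  funext k j
  by_cases hki : k = i.1
  · subst hki
    rw [Function.update_self, Pi.add_apply]
    by_cases hj : j ∈ (players h).erase i.1
    · conv_lhs => rw [bidOf, dif_pos i.2, dif_pos hj, Function.update_self]
    · rw [bidOf_eq_zero_of_notMem _ _ _ hj, bidOf_eq_zero_of_notMem _ _ _ hj, hδ j hj, add_zero]
  · rw [Function.update_of_ne hki]
    by_cases hj : j ∈ (players h).erase k
    · by_cases hkP : k ∈ players h
      · rw [bidOf, bidOf, dif_pos hkP, dif_pos hj, dif_pos hkP, dif_pos hj, Function.update_of_ne]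
        exact fun e => hki (congrArg Subtype.val e)
      · rw [bidOf, bidOf, dif_neg hkP, dif_neg hkP]
    · rw [bidOf_eq_zero_of_notMem _ _ _ hj, bidOf_eq_zero_of_notMem _ _ _ hj]

/-- The equilibrium payoffs of a round in which the payoffs after the rejection of an offer of `i`
are `c i`. -/
theorem determined_biddingRound {w : N → ℝ} (hw : ∀ i, 0 < w i) (v : SimpleGraph N → ℝ)
    {h : SimpleGraph N} (hh : (players h).Nonempty) {next : players h → ExtGame N}
    {c : N → N → ℝ} (hnext : ∀ i : players h, Determined (next i) (c i))
    (hself : ∀ i, c i i = 0) (hout : ∀ i, ∀ j ∉ players h, c i j = 0)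
    (hle : ∀ i ∈ players h, ∑ j ∈ (players h).erase i, c i j ≤ v h)
    {u : N → ℝ} (hu0 : ∀ i ∉ players h, u i = 0)
    (hu : ∀ i ∈ players h, (∑ j ∈ players h, w j) * u i =
      ∑ j ∈ players h, w j * proposerPayoffs v h (c j) j i) :
    Determined (biddingRound w v h next) u := by
  rintro σ ⟨hN, hS⟩
  set D : N → N → ℝ := fun k => proposerPayoffs v h (c k) k with hD
  set b := bidOf h σ.actions with hbdef
  have hdraw : ∀ (β : (i : players h) → Promise h i) (k : topBidders w h (bidOf h β)),
      Determined _ (fun i => proposalPayoff h (bidOf h β) D k i) := fun β k =>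
    (determined_offer v h k.1 (hnext ⟨k.1, mem_players_of_mem_topBidders k.2⟩) (hself k) (hout k)
      (hle k (mem_players_of_mem_topBidders k.2))).transfer (bidPayments h (bidOf h β) k)
  -- All bid profiles are needed, since deviations must be evaluated too.
  have hpay : ∀ (β : (i : players h) → Promise h i) (i : N),
      payoff _ (σ.afterMove β) i = expectedPayoff w h (bidOf h β) D i := by
    intro β i
    rw [expectedPayoff, ← Finset.sum_coe_sort]
    refine congrArg (· / _) (Finset.sum_congr rfl fun k _ => ?_)
    exact congrFun (hdraw β k _ ((hS β).2 k)).1 i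
  have hb : IsBiddingEquilibrium w h D b := by
    intro i hi δ hδ
    have h1 := hN.payoff_update_actions_le ⟨i, hi⟩
      (show Promise h i from fun k => bidOf h σ.actions i k + δ k)
    have h2 := ((hpay _ i).symm.trans_le h1).trans_eq (hpay _ i)
    have h3 := bidOf_update h σ.actions ⟨i, hi⟩ δ hδ
    rw [h3] at h2
    exact h2
  have hval : ∀ k ∈ players h, (fun i => proposalPayoff h b D k i) = u := by
    intro k hk
    funext i
    by_cases hi : i ∈ players h
    · exact mul_left_cancel₀ (sum_players_pos hw hi).ne'
        ((hb.weighted_payoff_eq hw hi hk).trans (hu i hi).symm)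
    · have hik : i ≠ k := fun e => hi (e ▸ hk)
      rw [proposalPayoff, bidPayments, if_neg hik, hD, hu0 i hi]
      simp only [proposerPayoffs, if_neg hik, hout k i hi, add_zero]
      exact bidOf_eq_zero_of_notMem _ _ _ fun hi' => hi (Finset.mem_of_mem_erase hi')
  refine ⟨?_, ?_⟩
  · funext i
    refine (hpay σ.actions i).trans ?_
    rw [expectedPayoff, Finset.sum_congr rfl fun k hk =>
      congrFun (hval k (mem_players_of_mem_topBidders hk)) i, Finset.sum_const, nsmul_eq_mul]
    refine mul_div_cancel_left₀ _ (Nat.cast_ne_zero.2 (Finset.card_ne_zero.2 ?_))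
    exact topBidders_nonempty w hh _
  · rintro x ⟨k, hk⟩
    rw [← hval k (mem_players_of_mem_topBidders k.2)]
    exact (hdraw σ.actions k _ ((hS σ.actions).2 k)).2 x hk

/-- The network g stays fixed, so its hypotheses serve every k ≤ g in the induction. -/
theorem determined_biddingMechanism {w : N → ℝ} (hw : ∀ i, 0 < w i) {g : SimpleGraph N}
    {v : SimpleGraph N → ℝ} (hv : IsComponentAdditive v) (hzm : IsZeroMonotonic g v)
    (hlink : ∀ i j, g.Adj i j → 0 ≤ v (SimpleGraph.edge i j)) (k : SimpleGraph N) (hk : k ≤ g) :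
    Determined (biddingMechanism w v k) (weightedMyerson w k v) := by
  induction k using WellFoundedLT.induction with
  | ind k ih =>
  rw [biddingMechanism, funext fun i => weightedMyerson_eq_sum_netComponents w k hv i]
  have hround : ∀ h : {h // h ∈ netComponents k}, Determined
      (biddingRound w v h.1 fun i => biddingMechanism w v (h.1 \ linksOf h.1 i.1))
      (weightedMyerson w h.1 v) := by
    rintro ⟨h, hh⟩
    have hcomp := isNetworkComponent_of_mem hh
    have hsum : ∀ i, ∑ j ∈ (players h).erase i, weightedMyerson w (h \ linksOf h i) v j =
      v (h \ linksOf h i) := fun i => sum_erase_weightedMyerson hw h hv.empty i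
    refine determined_biddingRound hw v (players_nonempty hcomp.1)
      (c := fun i => weightedMyerson w (h \ linksOf h i) v) ?_ ?_ ?_ ?_ ?_ ?_
    · rintro ⟨i, hi⟩
      refine ih _ (lt_of_le_of_ne (sdiff_le.trans hcomp.2.1) fun e => ?_)
        (sdiff_le.trans (hcomp.2.1.trans hk))
      have h1 := notMem_players_sdiff_linksOf h i
      rw [e] at h1
      exact h1 (players_mono hcomp.2.1 hi)
    · exact fun i => weightedMyerson_eq_zero _ _ _ (notMem_players_sdiff_linksOf h i)
    · exact fun i j hj => weightedMyerson_eq_zero _ _ _ fun hj' => hj (players_mono sdiff_le hj')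
    · intro i hi
      rw [hsum]
      exact value_sdiff_linksOf_le hv.empty hzm hlink (hcomp.2.1.trans hk) hi
    · exact fun i hi => weightedMyerson_eq_zero _ _ _ hi
    · intro i hi
      -- The term j = i of the recursion vanishes, as i has no links left; its place is taken by i's
      -- surplus as proposer.
      rw [weightedMyerson_recursion hw, ← Finset.add_sum_erase _ _ hi,
        ← Finset.add_sum_erase (players h) (fun j => w j * proposerPayoffs v h _ j i) hi,
        weightedMyerson_eq_zero _ _ _ (notMem_players_sdiff_linksOf h i), mul_zero, zero_add,
        proposerPayoffs, if_pos rfl, hsum]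
      refine congrArg _ (Finset.sum_congr rfl fun j hj => ?_)
      rw [proposerPayoffs, if_neg (Finset.ne_of_mem_erase hj).symm]
  have hpar := determined_parallel hround
  have heq : (fun i => ∑ h : {h // h ∈ netComponents k}, weightedMyerson w h.1 v i) =
      fun i => ∑ h ∈ netComponents k, weightedMyerson w h v i :=
    funext fun i => Finset.sum_coe_sort (netComponents k) fun h => weightedMyerson w h v i
  rw [heq] at hpar
  exact hpar

end Equilibrium

theorem mainTheorem7 {N : Type} [Fintype N] [LinearOrder N]
    (w : N → ℝ) (hw : ∀ i, 0 < w i)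
    (g : SimpleGraph N) (v : SimpleGraph N → ℝ)
    (hv : IsComponentAdditive v) (hzm : IsZeroMonotonic g v)
    (hlink : ∀ i j, g.Adj i j → 0 ≤ v (SimpleGraph.edge i j))
    (σ : (biddingMechanism w v g).Profile)
    (hσ : (biddingMechanism w v g).IsSubgamePerfect σ) :
    (∀ i, (biddingMechanism w v g).payoff σ i = weightedMyerson w g v i) ∧
    (∀ x ∈ (biddingMechanism w v g).outcomes σ, ∀ i, x i = weightedMyerson w g v i) := by
  obtain ⟨h1, h2⟩ := determined_biddingMechanism hw hv hzm hlink g le_rfl σ hσ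
  exact ⟨fun i => congrFun h1 i, fun x hx i => congrFun (h2 x hx) i⟩
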